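/- **Setting.** There are $L\ge 1$ networks on $n$ common nodes, with adjacency matrices $A_l\in\{0,1\}^{n\times n}$ (symmetric, zero diagonal), drawn from a multi-layer stochastic block model: node $i$ has community $g_i\in\{1,\dots,K\}$, the $B_l\in[0,1]^{K\times K}$ are symmetric link probability matrices, and independently for all $l$ and $i<j$, $A_{l,ij}\sim\mathrm{Bernoulli}(B_{l,g_ig_j})$. Let $1/2<q,q'\le 1$. Randomized response produces symmetric, zero-diagonal $\tilde A_l$: independently for all $l$ and $i<j$, an entry $1$ of $A_l$ is kept with probability $q$ (else becomes $0$) and an entry $0$ is kept with probability $q'$ (else becomes $1$). Let $\Theta\in\{0,1\}^{n\times K}$ be the membership matrix ($\Theta_{ik}=1$ iff $g_i=k$), $n_k$ the size of community $k$, $\Delta=\mathrm{diag}(\sqrt{n_1},\dots,\sqrt{n_K})$, $P_l=\Theta B_l\Theta^{\intercal}$, $Q_l=P_l^2/n$ and $Q=\frac1L\sum_l Q_l$. Assume that $Q$ has rank $K$; let $\lambda_{\min}(Q)$ be its smallest nonzero eigenvalue and let $V\in\mathbb R^{n\times K}$ consist of orthonormal eigenvectors of its $K$ largest eigenvalues.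 $\|\cdot\|_2$ is the spectral norm and, for matrices with orthonormal columns, $\mathrm{dist}(U,U')=\|UU^{\intercal}-U'U'^{\intercal}\|_2$. **Algorithm ppDSC.** Put $$\overline A_l=\frac{\tilde A_l-(1-q')\mathbf 1\mathbf 1^{\intercal}+(1-q')I}{q+q'-1},\qquad \overline M_l=\frac{\overline A_l^2}{n}-\frac{(q')^2}{n(q+q'-1)^2}G_l,$$ where $G_l$ is diagonal with $G_{l,ii}=\sum_j\tilde A_{l,ij}$. Let $\hat V_l\in\mathbb R^{n\times K}$ consist of orthonormal eigenvectors of the $K$ largest eigenvalues of $\overline M_l$. For a fixed reference index $o$, let $Z_l$ minimize $\|\hat V_lZ-\hat V_o\|_F$ over orthogonal $Z\in\mathbb R^{K\times K}$, put $\bar V=\frac1L\sum_l\hat V_lZ_l$, and let $\tilde V$ (with orthonormal columns) be the $Q$-factor of a QR decomposition of $\bar V$. The output eigen-space is $\tilde V$. **Theorem (Error Decomposition).** For all constants $0\le c_1\le C_1$ there are constants $c,C>0$, depending only on $c_1,C_1$, such that the following holds for all $n,K,L,g,(B_l)_l,q,q',o$ as above and all real $\mathcal H$. Assume that the communities are balanced,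 $c_1\frac nK\le n_k\le C_1\frac nK$ for all $k$, and that the heterogeneity is limited, $$\max_l\Big\|B_l\Delta^2B_l-\frac1L\sum_{l'=1}^LB_{l'}\Delta^2B_{l'}\Big\|_2\le\mathcal H.$$ Put $$\mathcal I_1=\max_l\frac{\|\overline M_l-Q_l\|_2^2}{\lambda_{\min}^2(Q)},\qquad \mathcal I_2=\frac{\mathcal H^2}{\lambda_{\min}^2(Q)},\qquad \mathcal I_3=\frac{\big\|\frac1L\sum_l\overline M_l-Q\big\|_2}{\lambda_{\min}(Q)}$$ (the local, heterogeneity and centralized errors). Then for every realization of the networks with $\mathcal I_1\le c$ and $\mathcal I_2\le c$, every output $\tilde V$ of ppDSC satisfies $$\mathrm{dist}(\tilde V,V)\le C\,(\mathcal I_1+\mathcal I_2+\mathcal I_3).$$ -/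

import Mathlib

open MeasureTheory ProbabilityTheory
open scoped Matrix Matrix.Norms.L2Operator

/-! Matrix norms `‖A‖` below are spectral norms (the operator norm induced by the Euclidean
vector norm). -/

noncomputable section

namespace PpDSC

/-- The Frobenius norm of a real matrix. -/
def frobeniusNorm {m k : ℕ} (A : Matrix (Fin m) (Fin k) ℝ) : ℝ :=
  Real.sqrt (∑ i, ∑ j, A i j ^ 2)

/-- The smallest nonzero eigenvalue of a square matrix. -/
def lambdaMin {n : ℕ} (A : Matrix (Fin n) (Fin n) ℝ) : ℝ :=
  sInf {x : ℝ | x ≠ 0 ∧ Module.End.HasEigenvalue (Matrix.toLin' A) x}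

/-- The projection distance between two matrices with orthonormal columns. -/
def dist {n K : ℕ} (U U' : Matrix (Fin n) (Fin K) ℝ) : ℝ :=
  ‖U * Uᵀ - U' * U'ᵀ‖

/-- `V` consists of the first `K` columns of `U` in some eigen-decomposition `M = U Λ Uᵀ` with
`U` orthogonal and the eigenvalues in decreasing order. -/
def IsLeadingEigenvectors {n K : ℕ} (M : Matrix (Fin n) (Fin n) ℝ)
    (V : Matrix (Fin n) (Fin K) ℝ) : Prop :=
  ∃ (hK : K ≤ n) (U : Matrix (Fin n) (Fin n) ℝ) (d : Fin n → ℝ),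
    U ∈ Matrix.orthogonalGroup (Fin n) ℝ ∧ Antitone d ∧
    M = U * Matrix.diagonal d * Uᵀ ∧ ∀ i k, V i k = U i (Fin.castLE hK k)

/-! ### The stochastic block models -/

/-- The number of nodes in community `k`. -/
def communitySize {n K : ℕ} (g : Fin n → Fin K) (k : Fin K) : ℕ :=
  (Finset.univ.filter fun i => g i = k).card

/-- The membership matrix `Θ`. -/
def membership {n K : ℕ} (g : Fin n → Fin K) : Matrix (Fin n) (Fin K) ℝ :=
  Matrix.of fun i k => if g i = k then 1 else 0

/-- The diagonal matrix `Δ` with diagonal entries the square roots of the community sizes. -/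
def deltaMat {n K : ℕ} (g : Fin n → Fin K) : Matrix (Fin K) (Fin K) ℝ :=
  Matrix.diagonal fun k => Real.sqrt (communitySize g k)

/-- The population matrix `Θ B Θᵀ` of one layer. -/
def population {n K : ℕ} (g : Fin n → Fin K) (B : Matrix (Fin K) (Fin K) ℝ) :
    Matrix (Fin n) (Fin n) ℝ :=
  membership g * B * (membership g)ᵀ

/-- The squared population matrix of one layer, divided by `n`. -/
def localTarget {n K : ℕ} (g : Fin n → Fin K) (B : Matrix (Fin K) (Fin K) ℝ) :
    Matrix (Fin n) (Fin n) ℝ :=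
  (n : ℝ)⁻¹ • population g B ^ 2

/-- The average of the local targets over the layers. -/
def target {n K L : ℕ} (g : Fin n → Fin K) (B : Fin L → Matrix (Fin K) (Fin K) ℝ) :
    Matrix (Fin n) (Fin n) ℝ :=
  (L : ℝ)⁻¹ • ∑ l, localTarget g (B l)

/-- Balanced communities: `c n / K ≤ n_k ≤ C n / K` for all `k`. -/
def Balanced {n K : ℕ} (c C : ℝ) (g : Fin n → Fin K) : Prop :=
  ∀ k, c * ((n : ℝ) / K) ≤ communitySize g k ∧ (communitySize g k : ℝ) ≤ C * ((n : ℝ) / K)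

/-- Limited heterogeneity of the link probability matrices, with bound `H`. -/
def LimitedHeterogeneity {n K L : ℕ} (g : Fin n → Fin K)
    (B : Fin L → Matrix (Fin K) (Fin K) ℝ) (H : ℝ) : Prop :=
  ∀ l, ‖B l * deltaMat g ^ 2 * B l - (L : ℝ)⁻¹ • ∑ l', B l' * deltaMat g ^ 2 * B l'‖ ≤ H

/-- Link probability matrices: symmetric, with entries in `[0, 1]`. -/
structure IsLinkMatrix {K : ℕ} (B : Matrix (Fin K) (Fin K) ℝ) : Prop where
  isSymm : B.IsSymm
  mem_Icc : ∀ a b, B a b ∈ Set.Icc (0 : ℝ) 1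

/-- The random adjacency matrices `A l` follow the multi-layer stochastic block model with
communities `g` and link probability matrices `B`, and `At l` is the perturbation of `A l` by
randomized response: independently for all layers and all pairs `i < j`, `A l i j` is Bernoulli
with parameter `B l (g i) (g j)`, an entry `1` is kept with probability `q`, and an entry `0` is
kept with probability `q'`. -/
structure IsPerturbedMultilayerSBM {Ω : Type*} [MeasurableSpace Ω] (μ : Measure Ω)
    {n K L : ℕ} (g : Fin n → Fin K) (B : Fin L → Matrix (Fin K) (Fin K) ℝ) (q q' : ℝ)
    (A At : Fin L → Ω → Matrix (Fin n) (Fin n) ℝ) : Prop where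
  isAdjMatrix : ∀ l ω, (A l ω).IsAdjMatrix
  isAdjMatrix_perturbed : ∀ l ω, (At l ω).IsAdjMatrix
  measurable : ∀ l i j, Measurable fun ω => A l ω i j
  measurable_perturbed : ∀ l i j, Measurable fun ω => At l ω i j
  bernoulli : ∀ l i j, i < j →
    μ {ω | A l ω i j = 1} = ENNReal.ofReal (B l (g i) (g j))
  keep_one : ∀ l i j, i < j →
    μ {ω | A l ω i j = 1 ∧ At l ω i j = 1} = ENNReal.ofReal q * μ {ω | A l ω i j = 1}
  keep_zero : ∀ l i j, i < j →
    μ {ω | A l ω i j = 0 ∧ At l ω i j = 0} = ENNReal.ofReal q' * μ {ω | A l ω i j = 0}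
  indep : iIndepFun
    (fun (e : {e : Fin L × Fin n × Fin n // e.2.1 < e.2.2}) (ω : Ω) =>
      (A e.1.1 ω e.1.2.1 e.1.2.2, At e.1.1 ω e.1.2.1 e.1.2.2)) μ

/-! ### The algorithm -/

/-- First bias correction: `[At - (1 - q') 1 1ᵀ + diag(1 - q')] / (q + q' - 1)`. -/
def debias {n : ℕ} (q q' : ℝ) (At : Matrix (Fin n) (Fin n) ℝ) : Matrix (Fin n) (Fin n) ℝ :=
  (q + q' - 1)⁻¹ •
    (At - (1 - q') • (Matrix.of fun _ _ => (1 : ℝ)) + Matrix.diagonal fun _ => 1 - q')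

/-- Second bias correction: the debiased estimator of the local target computed from the perturbed
adjacency matrix `At`, whose row sums are the entries of the diagonal correction. -/
def localEstimator {n : ℕ} (q q' : ℝ) (At : Matrix (Fin n) (Fin n) ℝ) :
    Matrix (Fin n) (Fin n) ℝ :=
  (n : ℝ)⁻¹ • debias q q' At ^ 2 -
    (q' ^ 2 / (n * (q + q' - 1) ^ 2)) • Matrix.diagonal fun i => ∑ j, At i j

/-- `Z` minimizes `‖V₂ Z - V₁‖_F` over the orthogonal matrices. -/
def IsProcrustes {n K : ℕ} (V₁ V₂ : Matrix (Fin n) (Fin K) ℝ) (Z : Matrix (Fin K) (Fin K) ℝ) :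
    Prop :=
  Z ∈ Matrix.orthogonalGroup (Fin K) ℝ ∧
    ∀ Z' ∈ Matrix.orthogonalGroup (Fin K) ℝ,
      frobeniusNorm (V₂ * Z - V₁) ≤ frobeniusNorm (V₂ * Z' - V₁)

/-- `(V, R)` is a (thin) QR decomposition of `W`. -/
def IsQR {n K : ℕ} (W V : Matrix (Fin n) (Fin K) ℝ) (R : Matrix (Fin K) (Fin K) ℝ) : Prop :=
  W = V * R ∧ Vᵀ * V = 1 ∧ ∀ i j, j < i → R i j = 0

/-- `Vt` is a possible output eigen-space of the algorithm run on the perturbed networks `At` with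
reference index `o`: local eigen-decompositions, Procrustes fixing, averaging, and QR
orthogonalization. All choices that the algorithm leaves open (of eigenvectors, of minimizers and
of the QR decomposition) are allowed. -/
def IsOutput {n L : ℕ} (K : ℕ) (q q' : ℝ) (o : Fin L)
    (At : Fin L → Matrix (Fin n) (Fin n) ℝ) (Vt : Matrix (Fin n) (Fin K) ℝ) : Prop :=
  ∃ (Vhat : Fin L → Matrix (Fin n) (Fin K) ℝ) (Z : Fin L → Matrix (Fin K) (Fin K) ℝ)
    (R : Matrix (Fin K) (Fin K) ℝ),
    (∀ l, IsLeadingEigenvectors (localEstimator q q' (At l)) (Vhat l)) ∧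
    (∀ l, IsProcrustes (Vhat o) (Vhat l) (Z l)) ∧
    IsQR ((L : ℝ)⁻¹ • ∑ l, Vhat l * Z l) Vt R

/-! ### The three error terms -/

/-- The local error. -/
def localError {n K L : ℕ} (g : Fin n → Fin K) (B : Fin L → Matrix (Fin K) (Fin K) ℝ)
    (q q' : ℝ) (At : Fin L → Matrix (Fin n) (Fin n) ℝ) : ℝ :=
  ⨆ l, ‖localEstimator q q' (At l) - localTarget g (B l)‖ ^ 2 / lambdaMin (target g B) ^ 2

/-- The heterogeneity error. -/
def heterogeneityError {n K L : ℕ} (g : Fin n → Fin K)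
    (B : Fin L → Matrix (Fin K) (Fin K) ℝ) (H : ℝ) : ℝ :=
  H ^ 2 / lambdaMin (target g B) ^ 2

/-- The centralized error. -/
def centralizedError {n K L : ℕ} (g : Fin n → Fin K) (B : Fin L → Matrix (Fin K) (Fin K) ℝ)
    (q q' : ℝ) (At : Fin L → Matrix (Fin n) (Fin n) ℝ) : ℝ :=
  ‖(L : ℝ)⁻¹ • ∑ l, localEstimator q q' (At l) - target g B‖ / lambdaMin (target g B)

end PpDSC

end

/-!
To first order, the eigen-projections depend linearly on the local estimators, and the Procrustes
alignment adds no first-order error. Averaging therefore turns the first-order part of the local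
errors into the centralized error, and only second-order terms remain. The argument is
deterministic, for a fixed realization of the networks, and its constants are absolute.

Write `Q` for the target, `λ` for its smallest nonzero eigenvalue, `Π = VVᵀ`, `M l` for the local
estimators and `P l` for the projection onto their `K` leading eigenvectors `W l`. As no community
has more than `n` nodes, heterogeneity `H` of the link matrices gives `‖Q l - Q‖ ≤ H`
(`LimitedHeterogeneity.norm_localTarget_sub_target_le`), hence `‖M l - Q‖ ≤ δ λ` with
`δ = √I₁ + √I₂`. Everything then follows from three facts.

* `‖P l - Π‖ = O(δ)`: Weyl's inequality and the identity `(1 - Π) Q = 0` bound the residual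
  `(1 - Π) W l` (`IsLeadingEigenvectors.norm_residual_le`), and for spaces of equal dimension the
  residual controls the projection distance (`norm_projection_sub_le`).
* The Procrustes solution is the polar factor of `(W l)ᵀ W o`, which differs from `(W l)ᵀ W o` only
  to second order. So `W l * Z l` is `P l * W o` up to `O(δ²)` in the *spectral* norm, with no
  dependence on `K` (`IsProcrustes.norm_sub_le`), and the average of the aligned eigenvectors is
  `(mean of P l) * W o` up to `O(δ²)`.
* From `M l * P l = P l * M l` and `(1 - Π) Q = 0`, the block `(1 - Π) P l Π` equals
  `(1 - Π)(M l - Q) Q⁺` up to `O(δ²)` (`norm_offDiagonal_sub_le`). The leading term is linear in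
  `M l`, so averaging over `l` replaces the local errors by the centralized error.

The triangular factor of the QR decomposition is well conditioned, since the averaged matrix is
close to `W o`; it therefore preserves these orders (`dist_qr_average_le`).
-/

namespace PpDSC

open Matrix

/-! ### The spectral norm of a real matrix -/

section Norm

variable {m n k : Type*} [Fintype m] [Fintype n] [Fintype k] [DecidableEq n]

lemma norm_transpose_matrix [DecidableEq m] (A : Matrix m n ℝ) : ‖Aᵀ‖ = ‖A‖ := by
  rw [← conjTranspose_eq_transpose_of_trivial, l2_opNorm_conjTranspose]

lemma norm_transpose_mul_self (A : Matrix m n ℝ) : ‖Aᵀ * A‖ = ‖A‖ ^ 2 := by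
  rw [← conjTranspose_eq_transpose_of_trivial, l2_opNorm_conjTranspose_mul_self, sq]

lemma norm_one_matrix_le : ‖(1 : Matrix n n ℝ)‖ ≤ 1 := by
  rw [← diagonal_one, l2_opNorm_diagonal]
  exact (pi_norm_le_iff_of_nonneg zero_le_one).2 fun i => by simp

lemma norm_mul_le_of_le [DecidableEq k] {A : Matrix m n ℝ} {B : Matrix n k ℝ} {a b : ℝ}
    (hA : ‖A‖ ≤ a) (hB : ‖B‖ ≤ b) : ‖A * B‖ ≤ a * b :=
  (l2_opNorm_mul A B).trans
    (mul_le_mul hA hB (norm_nonneg _) ((norm_nonneg _).trans hA))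

lemma norm_le_one_of_transpose_mul_self {U : Matrix m n ℝ} (hU : Uᵀ * U = 1) : ‖U‖ ≤ 1 := by
  have h := norm_transpose_mul_self U
  rw [hU] at h
  nlinarith [norm_one_matrix_le (n := n), norm_nonneg U]

lemma norm_transpose_le_one [DecidableEq m] {U : Matrix m n ℝ} (hU : Uᵀ * U = 1) : ‖Uᵀ‖ ≤ 1 := by
  rw [norm_transpose_matrix]
  exact norm_le_one_of_transpose_mul_self hU

lemma norm_projection_le_one [DecidableEq m] {U : Matrix m n ℝ} (hU : Uᵀ * U = 1) :
    ‖U * Uᵀ‖ ≤ 1 := by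
  simpa using norm_mul_le_of_le (norm_le_one_of_transpose_mul_self hU) (norm_transpose_le_one hU)

lemma transpose_one_sub_projection {m n : Type*} [Fintype n] [DecidableEq m]
    (U : Matrix m n ℝ) :
    (1 - U * Uᵀ)ᵀ = 1 - U * Uᵀ := by
  simp [transpose_sub, transpose_mul]

lemma projection_mul_projection {U : Matrix m n ℝ} (hU : Uᵀ * U = 1) :
    U * Uᵀ * (U * Uᵀ) = U * Uᵀ := by
  rw [Matrix.mul_assoc, ← Matrix.mul_assoc Uᵀ, hU, Matrix.one_mul]

lemma one_sub_projection_mul_self [DecidableEq m] {U : Matrix m n ℝ} (hU : Uᵀ * U = 1) :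
    (1 - U * Uᵀ) * (1 - U * Uᵀ) = 1 - U * Uᵀ := by
  simp only [Matrix.sub_mul, Matrix.mul_sub, projection_mul_projection hU, Matrix.one_mul,
    Matrix.mul_one, sub_self, sub_zero]

lemma norm_one_sub_projection_le_one [DecidableEq m] {U : Matrix m n ℝ} (hU : Uᵀ * U = 1) :
    ‖1 - U * Uᵀ‖ ≤ 1 := by
  have h := norm_transpose_mul_self (1 - U * Uᵀ)
  rw [transpose_one_sub_projection, one_sub_projection_mul_self hU] at h
  nlinarith [norm_nonneg (1 - U * Uᵀ)]

/-- The squared sines of the principal angles: for orthonormal columns `U`, `V`, the matrix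
`1 - YᵀY` with `Y = VᵀU` is the Gram matrix of the residual `(1 - VVᵀ) U`. -/
lemma norm_one_sub_gram [DecidableEq m] [DecidableEq k] {U : Matrix m n ℝ} {V : Matrix m k ℝ}
    (hU : Uᵀ * U = 1) (hV : Vᵀ * V = 1) :
    ‖1 - (Vᵀ * U)ᵀ * (Vᵀ * U)‖ = ‖(1 - V * Vᵀ) * U‖ ^ 2 := by
  rw [← norm_transpose_mul_self, transpose_mul (1 - V * Vᵀ), transpose_one_sub_projection,
    Matrix.mul_assoc, ← Matrix.mul_assoc (1 - V * Vᵀ), one_sub_projection_mul_self hV]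
  congr 1
  simp only [Matrix.mul_sub, Matrix.sub_mul, Matrix.one_mul, hU, transpose_mul,
    transpose_transpose, Matrix.mul_assoc]

/-- A square matrix with an approximate left inverse of norm at most one is invertible, and its
inverse is bounded. -/
lemma exists_inverse_norm_le_two {A Y : Matrix n n ℝ} (hA : ‖A‖ ≤ 1)
    (h : ‖1 - A * Y‖ ≤ 1 / 2) : ∃ W : Matrix n n ℝ, Y * W = 1 ∧ ‖W‖ ≤ 2 := by
  have hu : IsUnit (A * Y) := by
    have := isUnit_one_sub_of_norm_lt_one (x := 1 - A * Y) (by linarith)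
    simpa using this
  obtain ⟨u, hu⟩ := hu
  have hl : ((↑u⁻¹ : Matrix n n ℝ) * A) * Y = 1 := by
    rw [Matrix.mul_assoc, ← hu]
    exact u.inv_mul
  set W := (↑u⁻¹ : Matrix n n ℝ) * A
  have hr : Y * W = 1 := mul_eq_one_comm.mp hl
  refine ⟨W, hr, ?_⟩
  have hW : W = (1 - A * Y) * W + A := by
    rw [Matrix.sub_mul, Matrix.mul_assoc A, hr]
    simp
  have h1 : ‖W‖ ≤ ‖(1 - A * Y) * W‖ + ‖A‖ := by
    conv_lhs => rw [hW]
    exact norm_add_le _ _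
  have h2 := norm_mul_le_of_le h (le_refl ‖W‖)
  linarith

/-- For column spaces of equal dimension, the one-sided residual controls the distance of the
orthogonal projections. -/
lemma norm_projection_sub_le [DecidableEq m] {U V : Matrix m n ℝ} (hU : Uᵀ * U = 1)
    (hV : Vᵀ * V = 1) :
    ‖U * Uᵀ - V * Vᵀ‖ ≤ 3 * ‖(1 - V * Vᵀ) * U‖ := by
  set η := ‖(1 - V * Vᵀ) * U‖
  have hη0 : 0 ≤ η := norm_nonneg _
  set Y := Vᵀ * U with hY
  have hgram : ‖1 - Yᵀ * Y‖ = η ^ 2 := norm_one_sub_gram hU hV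
  rcases le_or_gt (η ^ 2) (1 / 2) with hs | hs
  · have hYn : ‖Y‖ ≤ 1 := by
      simpa using norm_mul_le_of_le (norm_transpose_le_one hV)
        (norm_le_one_of_transpose_mul_self hU)
    obtain ⟨W, hYW, hW⟩ := exists_inverse_norm_le_two (A := Yᵀ) (Y := Y)
      (by rwa [norm_transpose_matrix]) (by rw [hgram]; exact hs)
    -- `1 - YYᵀ` is similar to `1 - YᵀY`, which transfers the bound to the other residual.
    have hconj : 1 - Y * Yᵀ = Y * (1 - Yᵀ * Y) * W := by
      rw [Matrix.mul_sub, Matrix.sub_mul, Matrix.mul_one, hYW, ← Matrix.mul_assoc Y,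
        Matrix.mul_assoc (Y * Yᵀ), hYW, Matrix.mul_one]
    have hθ : ‖(1 - U * Uᵀ) * V‖ ^ 2 ≤ 1 * η ^ 2 * 2 := by
      rw [← norm_one_sub_gram hV hU]
      have : (Uᵀ * V)ᵀ * (Uᵀ * V) = Y * Yᵀ := by simp [hY, transpose_mul]
      rw [this, hconj]
      exact norm_mul_le_of_le (norm_mul_le_of_le hYn hgram.le) hW
    have hθ' : ‖(1 - U * Uᵀ) * V‖ ≤ 2 * η := by
      nlinarith [norm_nonneg ((1 - U * Uᵀ) * V)]
    have hdec : U * Uᵀ - V * Vᵀ = (1 - V * Vᵀ) * U * Uᵀ - V * ((1 - U * Uᵀ) * V)ᵀ := by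
      rw [transpose_mul, transpose_one_sub_projection]
      simp only [Matrix.mul_sub, Matrix.sub_mul, Matrix.one_mul, Matrix.mul_one, Matrix.mul_assoc]
      abel
    rw [hdec]
    have h1 : ‖(1 - V * Vᵀ) * U * Uᵀ‖ ≤ η * 1 :=
      norm_mul_le_of_le le_rfl (norm_transpose_le_one hU)
    have h2 : ‖V * ((1 - U * Uᵀ) * V)ᵀ‖ ≤ 1 * (2 * η) :=
      norm_mul_le_of_le (norm_le_one_of_transpose_mul_self hV)
        (by rw [norm_transpose_matrix]; exact hθ')
    linarith [norm_sub_le ((1 - V * Vᵀ) * U * Uᵀ) (V * ((1 - U * Uᵀ) * V)ᵀ)]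
  · -- for a large residual the trivial bound `2` on the distance suffices
    have h1 := norm_sub_le (U * Uᵀ) (V * Vᵀ)
    have h2 := norm_projection_le_one hU
    have h3 := norm_projection_le_one hV
    nlinarith

end Norm

/-! ### The orthogonal Procrustes problem -/

section Procrustes

variable {k : Type*} [Fintype k] [DecidableEq k]

/-- The polar decomposition of a matrix close to orthogonal: the positive factor is presented by
its eigen-decomposition. -/
lemma exists_polar {X : Matrix k k ℝ} (hX : ‖1 - Xᵀ * X‖ < 1) :
    ∃ (W O : Matrix k k ℝ) (t : k → ℝ), Wᵀ * W = 1 ∧ Oᵀ * O = 1 ∧ (∀ i, 0 < t i) ∧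
      X = W * (O * diagonal t * Oᵀ) ∧ ‖W - X‖ ≤ ‖1 - Xᵀ * X‖ := by
  have hH : (Xᵀ * X).IsHermitian := by
    have := isHermitian_conjTranspose_mul_self X
    rwa [conjTranspose_eq_transpose_of_trivial] at this
  set O : Matrix k k ℝ := (hH.eigenvectorUnitary : Matrix k k ℝ) with hO
  set s := hH.eigenvalues with hs
  have hOO : Oᵀ * O = 1 := by
    have := mem_unitaryGroup_iff'.mp hH.eigenvectorUnitary.2
    rwa [star_eq_conjTranspose, conjTranspose_eq_transpose_of_trivial] at this
  have hOO' : O * Oᵀ = 1 := mul_eq_one_comm.mp hOO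
  have hspec : Xᵀ * X = O * diagonal s * Oᵀ := by
    have := hH.spectral_theorem
    rw [Unitary.conjStarAlgAut_apply, star_eq_conjTranspose,
      conjTranspose_eq_transpose_of_trivial] at this
    exact this
  have hconj : ∀ a b : k → ℝ, (O * diagonal a * Oᵀ) * (O * diagonal b * Oᵀ) =
      O * diagonal (fun i => a i * b i) * Oᵀ := by
    intro a b
    calc (O * diagonal a * Oᵀ) * (O * diagonal b * Oᵀ)
        = O * diagonal a * (Oᵀ * O) * diagonal b * Oᵀ := by simp only [Matrix.mul_assoc]
      _ = _ := by rw [hOO, Matrix.mul_one, Matrix.mul_assoc O, diagonal_mul_diagonal]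
  have hsub : ∀ a : k → ℝ, 1 - O * diagonal a * Oᵀ = O * diagonal (fun i => 1 - a i) * Oᵀ := by
    intro a
    have : diagonal (fun i => 1 - a i) = (1 : Matrix k k ℝ) - diagonal a := by
      rw [← diagonal_one, diagonal_sub]
    rw [this, Matrix.mul_sub, Matrix.sub_mul, Matrix.mul_one, hOO']
  have hnorm : ‖fun i => 1 - s i‖ ≤ ‖1 - Xᵀ * X‖ := by
    have : diagonal (fun i => 1 - s i) = Oᵀ * (1 - Xᵀ * X) * O := by
      rw [hspec, hsub]
      calc diagonal (fun i => 1 - s i) = (Oᵀ * O) * diagonal (fun i => 1 - s i) * (Oᵀ * O) := by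
            rw [hOO]; simp
        _ = _ := by simp only [Matrix.mul_assoc]
    rw [← l2_opNorm_diagonal, this]
    simpa using norm_mul_le_of_le (norm_mul_le_of_le (norm_transpose_le_one hOO)
      (le_refl ‖1 - Xᵀ * X‖)) (norm_le_one_of_transpose_mul_self hOO)
  have hs1 : ∀ i, |1 - s i| ≤ ‖1 - Xᵀ * X‖ := fun i => by
    rw [← Real.norm_eq_abs]
    exact (norm_le_pi_norm (fun i => 1 - s i) i).trans hnorm
  have hs0 : ∀ i, 0 < s i := fun i => by
    have := (abs_lt.mp ((hs1 i).trans_lt hX)).2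
    linarith
  set t : k → ℝ := fun i => √(s i) with ht
  have ht0 : ∀ i, 0 < t i := fun i => Real.sqrt_pos.2 (hs0 i)
  have htt : ∀ i, t i * t i = s i := fun i => Real.mul_self_sqrt (hs0 i).le
  set T := O * diagonal t * Oᵀ with hT
  set T' := O * diagonal (fun i => (t i)⁻¹) * Oᵀ with hT'
  have hone : O * diagonal (fun _ => (1 : ℝ)) * Oᵀ = 1 := by
    rw [diagonal_one, Matrix.mul_one, hOO']
  have hTT' : T' * T = 1 := by
    rw [hT, hT', hconj, ← hone]
    simp [(ht0 _).ne']
  have hT't : T'ᵀ = T' := by simp [hT', transpose_mul, Matrix.mul_assoc]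
  have hXX : Xᵀ * X = T * T := by
    rw [hspec, hT, hconj]
    simp [htt]
  have hW : X = X * T' * T := by rw [Matrix.mul_assoc, hTT', Matrix.mul_one]
  have hWW : (X * T')ᵀ * (X * T') = 1 := by
    calc (X * T')ᵀ * (X * T') = T' * (Xᵀ * X) * T' := by
          rw [transpose_mul, hT't]
          simp only [Matrix.mul_assoc]
      _ = (T' * T) * (T * T') := by
          rw [hXX]
          simp only [Matrix.mul_assoc]
      _ = 1 := by rw [mul_eq_one_comm.mp hTT', hTT', Matrix.one_mul]
  refine ⟨X * T', O, t, hWW, hOO, ht0, hW, ?_⟩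
  have h1 : X * T' - X = X * T' * (1 - T) := by
    rw [Matrix.mul_sub, Matrix.mul_one, ← hW]
  have h2 : ‖1 - T‖ ≤ ‖1 - Xᵀ * X‖ := by
    rw [hT, hsub]
    have : ‖diagonal (fun i => 1 - t i)‖ ≤ ‖1 - Xᵀ * X‖ := by
      rw [l2_opNorm_diagonal]
      refine (pi_norm_le_iff_of_nonneg (norm_nonneg _)).2 fun i => ?_
      refine le_trans ?_ (hs1 i)
      -- `1 - s = (1 - t) (1 + t)` with `t ≥ 0`
      rw [← htt i, Real.norm_eq_abs, show 1 - t i * t i = (1 - t i) * (1 + t i) by ring, abs_mul]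
      refine le_mul_of_one_le_right (abs_nonneg _) ?_
      rw [abs_of_pos (by linarith [ht0 i])]
      linarith [ht0 i]
    simpa using norm_mul_le_of_le (norm_mul_le_of_le (norm_le_one_of_transpose_mul_self hOO)
      this) (norm_transpose_le_one hOO)
  rw [h1]
  simpa using norm_mul_le_of_le (norm_le_one_of_transpose_mul_self hWW) h2

/-- If `T = O diag(t) Oᵀ` is positive definite, then `tr(WT) ≥ tr T` for an orthogonal `W` forces
`W = 1`, because `tr ((1 - W) T (1 - W)ᵀ) = 2 (tr T - tr (WT))`. -/
lemma eq_one_of_trace_le {W O : Matrix k k ℝ} {t : k → ℝ} (hW : Wᵀ * W = 1)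
    (hO : Oᵀ * O = 1) (ht : ∀ i, 0 < t i)
    (h : (O * diagonal t * Oᵀ).trace ≤ (W * (O * diagonal t * Oᵀ)).trace) : W = 1 := by
  set T := O * diagonal t * Oᵀ with hT
  have hTt : Tᵀ = T := by simp [hT, transpose_mul, Matrix.mul_assoc]
  set A := (1 - W) * O with hA
  have htr : (A * diagonal t * Aᵀ).trace = 2 * (T.trace - (W * T).trace) := by
    have h1 : A * diagonal t * Aᵀ = T - W * T - T * Wᵀ + W * T * Wᵀ := by
      rw [hA, transpose_mul, transpose_sub, transpose_one]
      calc (1 - W) * O * diagonal t * (Oᵀ * (1 - Wᵀ))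
          = (1 - W) * T * (1 - Wᵀ) := by simp only [hT, Matrix.mul_assoc]
        _ = _ := by noncomm_ring
    have h2 : (T * Wᵀ).trace = (W * T).trace := by
      rw [← trace_transpose, transpose_mul, transpose_transpose, hTt]
    have h3 : (W * T * Wᵀ).trace = T.trace := by
      rw [trace_mul_comm, ← Matrix.mul_assoc, hW, Matrix.one_mul]
    rw [h1, trace_add, trace_sub, trace_sub, h2, h3]
    ring
  have hsum : (A * diagonal t * Aᵀ).trace = ∑ i, ∑ j, t j * A i j ^ 2 := by
    simp only [Matrix.trace, diag_apply, Matrix.mul_apply (N := Aᵀ), mul_diagonal, transpose_apply]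
    exact Finset.sum_congr rfl fun i _ => Finset.sum_congr rfl fun j _ => by ring
  have hnn : ∀ i j, 0 ≤ t j * A i j ^ 2 := fun i j => mul_nonneg (ht j).le (sq_nonneg _)
  have hz : ∑ i, ∑ j, t j * A i j ^ 2 = 0 :=
    le_antisymm (by rw [← hsum, htr]; linarith)
      (Finset.sum_nonneg fun i _ => Finset.sum_nonneg fun j _ => hnn i j)
  have hA0 : A = 0 := by
    ext i j
    have h1 := (Finset.sum_eq_zero_iff_of_nonneg
      (fun i _ => Finset.sum_nonneg fun j _ => hnn i j)).1 hz i (Finset.mem_univ i)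
    have h2 := (Finset.sum_eq_zero_iff_of_nonneg fun j _ => hnn i j).1 h1 j (Finset.mem_univ j)
    simpa [(ht j).ne'] using h2
  have : 1 - W = A * Oᵀ := by
    rw [hA, Matrix.mul_assoc, mul_eq_one_comm.mp hO, Matrix.mul_one]
  rw [hA0, Matrix.zero_mul] at this
  exact (sub_eq_zero.1 this).symm

/-- The orthogonal matrix maximizing `tr (ZᵀX)` is the polar factor of `X`, which agrees with `X`
up to the *quadratic* error `‖1 - XᵀX‖`. -/
lemma norm_sub_le_of_trace_maximal {X Z : Matrix k k ℝ} (hX : ‖1 - Xᵀ * X‖ < 1)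
    (hZ : Zᵀ * Z = 1) (hmax : ∀ W : Matrix k k ℝ, Wᵀ * W = 1 → (Wᵀ * X).trace ≤ (Zᵀ * X).trace) :
    ‖Z - X‖ ≤ ‖1 - Xᵀ * X‖ := by
  obtain ⟨W, O, t, hW, hO, ht, hXW, hle⟩ := exists_polar hX
  have hZ' : Z * Zᵀ = 1 := mul_eq_one_comm.mp hZ
  have h := hmax W hW
  rw [hXW, ← Matrix.mul_assoc, hW, Matrix.one_mul, ← Matrix.mul_assoc] at h
  have h1 : Zᵀ * W = 1 := by
    refine eq_one_of_trace_le ?_ hO ht h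
    rw [transpose_mul, transpose_transpose, Matrix.mul_assoc, ← Matrix.mul_assoc Z, hZ',
      Matrix.one_mul, hW]
  have h2 : W = Z := by
    rw [← Matrix.one_mul W, ← hZ', Matrix.mul_assoc, h1, Matrix.mul_one]
  rwa [← h2]

lemma sq_frobeniusNorm {m k : ℕ} (A : Matrix (Fin m) (Fin k) ℝ) :
    frobeniusNorm A ^ 2 = (Aᵀ * A).trace := by
  rw [frobeniusNorm, Real.sq_sqrt (by positivity), Finset.sum_comm]
  simp [Matrix.trace, Matrix.mul_apply, sq]

/-- The Procrustes alignment of `V₂` to `V₁` replaces `V₂ Z` by the projection of `V₁` onto the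
column space of `V₂`, up to a quadratic error. -/
lemma IsProcrustes.norm_sub_le {n K : ℕ} {V₁ V₂ : Matrix (Fin n) (Fin K) ℝ}
    {Z : Matrix (Fin K) (Fin K) ℝ} (h : IsProcrustes V₁ V₂ Z) (h₁ : V₁ᵀ * V₁ = 1)
    (h₂ : V₂ᵀ * V₂ = 1) (hlt : ‖(1 - V₂ * V₂ᵀ) * V₁‖ < 1) :
    ‖V₂ * Z - V₂ * V₂ᵀ * V₁‖ ≤ ‖(1 - V₂ * V₂ᵀ) * V₁‖ ^ 2 := by
  have hmem : ∀ W : Matrix (Fin K) (Fin K) ℝ,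
      W ∈ orthogonalGroup (Fin K) ℝ ↔ Wᵀ * W = 1 := fun W => by
    rw [mem_orthogonalGroup_iff']
  have hZ := (hmem Z).1 h.1
  have hexp : ∀ W : Matrix (Fin K) (Fin K) ℝ, Wᵀ * W = 1 →
      frobeniusNorm (V₂ * W - V₁) ^ 2 =
        2 * (1 : Matrix (Fin K) (Fin K) ℝ).trace - 2 * (Wᵀ * (V₂ᵀ * V₁)).trace := by
    intro W hW
    have h3 : (V₂ * W - V₁)ᵀ * (V₂ * W - V₁) =
        Wᵀ * (V₂ᵀ * V₂) * W - Wᵀ * (V₂ᵀ * V₁) - (Wᵀ * (V₂ᵀ * V₁))ᵀ + V₁ᵀ * V₁ := by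
      simp only [transpose_sub, transpose_mul, transpose_transpose, Matrix.sub_mul,
        Matrix.mul_sub, Matrix.mul_assoc]
      abel
    rw [sq_frobeniusNorm, h3, h₁, h₂, Matrix.mul_one, hW, trace_add, trace_sub, trace_sub,
      trace_transpose]
    ring
  have hnn : ∀ A : Matrix (Fin n) (Fin K) ℝ, 0 ≤ frobeniusNorm A := fun A => Real.sqrt_nonneg _
  have hmax : ∀ W : Matrix (Fin K) (Fin K) ℝ, Wᵀ * W = 1 →
      (Wᵀ * (V₂ᵀ * V₁)).trace ≤ (Zᵀ * (V₂ᵀ * V₁)).trace := by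
    intro W hW
    have h4 := pow_le_pow_left₀ (hnn _) (h.2 W ((hmem W).2 hW)) 2
    rw [hexp W hW, hexp Z hZ] at h4
    linarith
  have hg := norm_one_sub_gram h₁ h₂
  have h5 : ‖Z - V₂ᵀ * V₁‖ ≤ ‖(1 - V₂ * V₂ᵀ) * V₁‖ ^ 2 := by
    rw [← hg]
    refine norm_sub_le_of_trace_maximal ?_ hZ hmax
    rw [hg]
    exact pow_lt_one₀ (norm_nonneg _) hlt two_ne_zero
  rw [Matrix.mul_assoc, ← Matrix.mul_sub]
  simpa using norm_mul_le_of_le (norm_le_one_of_transpose_mul_self h₂) h5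

end Procrustes

/-! ### Leading eigenvectors -/

section Eigen

variable {n K : ℕ}

lemma dotProduct_self_eq_norm_sq (x : Fin n → ℝ) : x ⬝ᵥ x = ‖WithLp.toLp 2 x‖ ^ 2 := by
  rw [EuclideanSpace.norm_sq_eq]
  simp [dotProduct, sq]

lemma abs_dotProduct_mulVec_le (E : Matrix (Fin n) (Fin n) ℝ) (x : Fin n → ℝ) :
    |x ⬝ᵥ E *ᵥ x| ≤ ‖E‖ * (x ⬝ᵥ x) := by
  have h1 : x ⬝ᵥ E *ᵥ x = inner ℝ (WithLp.toLp 2 x) (WithLp.toLp 2 (E *ᵥ x)) := by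
    simp [PiLp.inner_apply, dotProduct, mul_comm]
  have h2 : ‖WithLp.toLp 2 (E *ᵥ x)‖ ≤ ‖E‖ * ‖WithLp.toLp 2 x‖ :=
    l2_opNorm_mulVec E (WithLp.toLp 2 x)
  rw [h1, dotProduct_self_eq_norm_sq]
  refine (abs_real_inner_le_norm _ _).trans ?_
  calc _ ≤ ‖WithLp.toLp 2 x‖ * (‖E‖ * ‖WithLp.toLp 2 x‖) := by gcongr
    _ = _ := by ring

lemma mulVec_dotProduct_mulVec_self {m : ℕ} {U : Matrix (Fin m) (Fin n) ℝ} (hU : Uᵀ * U = 1)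
    (x : Fin n → ℝ) : (U *ᵥ x) ⬝ᵥ (U *ᵥ x) = x ⬝ᵥ x := by
  rw [dotProduct_mulVec, vecMul_mulVec, ← dotProduct_mulVec, hU, one_mulVec]

lemma dotProduct_conj_diagonal_mulVec {m : ℕ} (U : Matrix (Fin m) (Fin n) ℝ) (d : Fin n → ℝ)
    (x : Fin m → ℝ) :
    x ⬝ᵥ (U * diagonal d * Uᵀ) *ᵥ x = ∑ i, d i * (Uᵀ *ᵥ x) i ^ 2 := by
  rw [← mulVec_mulVec, ← mulVec_mulVec, dotProduct_mulVec, ← mulVec_transpose, dotProduct]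
  refine Finset.sum_congr rfl fun i _ => ?_
  rw [mulVec_diagonal]
  ring

/-- **Weyl's inequality** for the leading eigenvalues: they are at least `lam - ‖M - Q‖` if `Q`
is at least `lam` on a `K`-dimensional column space. -/
lemma sub_norm_le_eigenvalue {Q M U : Matrix (Fin n) (Fin n) ℝ} {V : Matrix (Fin n) (Fin K) ℝ}
    {d : Fin K → ℝ} {e : Fin n → ℝ} {lam : ℝ} (hV : Vᵀ * V = 1) (hQ : Q = V * diagonal d * Vᵀ)
    (hd : ∀ k, lam ≤ d k) (hU : Uᵀ * U = 1) (hM : M = U * diagonal e * Uᵀ) (he : Antitone e)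
    (k : Fin n) (hk : (k : ℕ) < K) : lam - ‖M - Q‖ ≤ e k := by
  -- A vector of the column space of `V` orthogonal to the first `k` eigenvectors of `M`.
  obtain ⟨y, hy0, hy⟩ : ∃ y : Fin K → ℝ, y ≠ 0 ∧ ∀ j : Fin n, j < k → (Uᵀ *ᵥ (V *ᵥ y)) j = 0 := by
    let f : (Fin K → ℝ) →ₗ[ℝ] (Fin (k : ℕ) → ℝ) :=
      (LinearMap.funLeft ℝ ℝ (Fin.castLE k.2.le)) ∘ₗ (Matrix.toLin' (Uᵀ * V))
    have hf : LinearMap.ker f ≠ ⊥ := LinearMap.ker_ne_bot_of_finrank_lt (by simpa using hk)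
    obtain ⟨y, hy, hy0⟩ := Submodule.exists_mem_ne_zero_of_ne_bot hf
    refine ⟨y, hy0, fun j hj => ?_⟩
    have := congrFun (LinearMap.mem_ker.1 hy) ⟨j, hj⟩
    rw [mulVec_mulVec]
    simpa [f, LinearMap.funLeft] using this
  set x := V *ᵥ y with hx
  have hxx : x ⬝ᵥ x = y ⬝ᵥ y := mulVec_dotProduct_mulVec_self hV y
  have hww : (Uᵀ *ᵥ x) ⬝ᵥ (Uᵀ *ᵥ x) = x ⬝ᵥ x :=
    mulVec_dotProduct_mulVec_self (by simpa using mul_eq_one_comm.mp hU) x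
  have hypos : 0 < y ⬝ᵥ y := by
    have h0 : 0 ≤ y ⬝ᵥ y := Finset.sum_nonneg fun i _ => mul_self_nonneg _
    exact lt_of_le_of_ne h0 fun h => hy0 (dotProduct_self_eq_zero.1 h.symm)
  have h1 : lam * (y ⬝ᵥ y) ≤ x ⬝ᵥ Q *ᵥ x := by
    rw [hQ, dotProduct_conj_diagonal_mulVec, hx, mulVec_mulVec, hV, one_mulVec, dotProduct,
      Finset.mul_sum]
    refine Finset.sum_le_sum fun i _ => ?_
    nlinarith [hd i, sq_nonneg (y i)]
  have h2 : x ⬝ᵥ M *ᵥ x ≤ e k * (y ⬝ᵥ y) := by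
    rw [hM, dotProduct_conj_diagonal_mulVec, ← hxx, ← hww, dotProduct, Finset.mul_sum]
    refine Finset.sum_le_sum fun i _ => ?_
    rcases lt_or_ge i k with hik | hik
    · simp [hy i hik]
    · nlinarith [he hik, sq_nonneg ((Uᵀ *ᵥ x) i)]
  have h3 := abs_le.1 (abs_dotProduct_mulVec_le (M - Q) x)
  rw [sub_mulVec, dotProduct_sub, hxx] at h3
  by_contra hlt
  push Not at hlt
  nlinarith

lemma IsLeadingEigenvectors.exists_eigenvalues {M : Matrix (Fin n) (Fin n) ℝ}
    {V : Matrix (Fin n) (Fin K) ℝ} (h : IsLeadingEigenvectors M V) :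
    ∃ (hK : K ≤ n) (U : Matrix (Fin n) (Fin n) ℝ) (d : Fin n → ℝ), Uᵀ * U = 1 ∧ Antitone d ∧
      M = U * diagonal d * Uᵀ ∧ (∀ i k, V i k = U i (Fin.castLE hK k)) ∧ Vᵀ * V = 1 ∧
      M * V = V * diagonal (fun k => d (Fin.castLE hK k)) := by
  obtain ⟨hK, U, d, hU, hd, hM, hVU⟩ := h
  have hUU : Uᵀ * U = 1 := (mem_orthogonalGroup_iff' _ _).1 hU
  have hV : V = U.submatrix id (Fin.castLE hK) := by
    ext i k
    exact hVU i k
  refine ⟨hK, U, d, hUU, hd, hM, hVU, ?_, ?_⟩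
  · rw [hV, transpose_submatrix, ← submatrix_mul _ _ _ id _ Function.bijective_id, hUU]
    exact submatrix_one _ (Fin.castLE_injective hK)
  · have h1 : M * U = U * diagonal d := by
      rw [hM, Matrix.mul_assoc, hUU, Matrix.mul_one]
    ext i k
    have h2 := congrFun (congrFun h1 i) (Fin.castLE hK k)
    rw [mul_diagonal] at h2 ⊢
    rw [hVU, ← h2]
    simp [Matrix.mul_apply, hVU]

lemma IsLeadingEigenvectors.transpose_mul_self {M : Matrix (Fin n) (Fin n) ℝ}
    {V : Matrix (Fin n) (Fin K) ℝ} (h : IsLeadingEigenvectors M V) : Vᵀ * V = 1 := by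
  obtain ⟨-, -, -, -, -, -, -, hV, -⟩ := h.exists_eigenvalues
  exact hV

/-- A **Davis–Kahan** bound: the leading eigenvectors of a perturbation of `Q = V diag(d) Vᵀ` are
almost contained in the column space of `V`. -/
lemma IsLeadingEigenvectors.norm_residual_le {Q M : Matrix (Fin n) (Fin n) ℝ}
    {V W : Matrix (Fin n) (Fin K) ℝ} {d : Fin K → ℝ} {lam δ : ℝ} (hlam : 0 < lam)
    (hW : IsLeadingEigenvectors M W)
    (hV : Vᵀ * V = 1) (hQ : Q = V * diagonal d * Vᵀ) (hd : ∀ k, lam ≤ d k)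
    (hE : ‖M - Q‖ ≤ δ * lam) (hδ : δ ≤ 1 / 2) :
    ‖(1 - V * Vᵀ) * W‖ ≤ 2 * δ := by
  obtain ⟨hK, U, e, hU, he, hM, -, hWW, hMW⟩ := hW.exists_eigenvalues
  have he2 : ∀ k : Fin K, lam / 2 ≤ e (Fin.castLE hK k) := fun k => by
    have := sub_norm_le_eigenvalue hV hQ hd hU hM he (Fin.castLE hK k) k.2
    nlinarith
  have hepos : ∀ k : Fin K, 0 < e (Fin.castLE hK k) := fun k => by
    have := he2 k
    linarith
  set D' : Matrix (Fin K) (Fin K) ℝ := diagonal (fun k => (e (Fin.castLE hK k))⁻¹) with hD'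
  have hD'n : ‖D'‖ ≤ 2 / lam := by
    rw [hD', l2_opNorm_diagonal]
    refine (pi_norm_le_iff_of_nonneg (by positivity)).2 fun k => ?_
    rw [Real.norm_eq_abs, abs_of_pos (inv_pos.2 (hepos k)), show 2 / lam = (lam / 2)⁻¹ by simp]
    exact inv_anti₀ (by positivity) (he2 k)
  have hWD : M * W * D' = W := by
    rw [hMW, Matrix.mul_assoc, hD', diagonal_mul_diagonal]
    simp [(hepos _).ne']
  have hPQ : (1 - V * Vᵀ) * Q = 0 := by
    rw [hQ, Matrix.sub_mul, Matrix.one_mul, sub_eq_zero]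
    calc V * diagonal d * Vᵀ = V * (Vᵀ * V) * diagonal d * Vᵀ := by rw [hV, Matrix.mul_one]
      _ = _ := by simp only [Matrix.mul_assoc]
  have hres : (1 - V * Vᵀ) * W = (1 - V * Vᵀ) * (M - Q) * W * D' := by
    rw [Matrix.mul_sub, hPQ, sub_zero]
    conv_lhs => rw [← hWD]
    simp only [Matrix.mul_assoc]
  rw [hres]
  have := norm_mul_le_of_le (norm_mul_le_of_le (norm_mul_le_of_le
    (norm_one_sub_projection_le_one hV) hE) (norm_le_one_of_transpose_mul_self hWW)) hD'n
  refine this.trans (le_of_eq ?_)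
  field_simp

/-- A positive semidefinite matrix of rank `K` is recovered from `K` leading eigenvectors: its
remaining eigenvalues vanish. -/
lemma IsLeadingEigenvectors.eq_of_rank_eq {Q : Matrix (Fin n) (Fin n) ℝ}
    {V : Matrix (Fin n) (Fin K) ℝ} (hV : IsLeadingEigenvectors Q V) (hQ : Q.PosSemidef)
    (hr : Q.rank = K) :
    ∃ d : Fin K → ℝ, Q = V * diagonal d * Vᵀ ∧ (∀ k, 0 < d k) ∧
      ∀ k, Module.End.HasEigenvalue (Matrix.toLin' Q) (d k) := by
  obtain ⟨hK, U, d, hU, hd, hM, hVU, hVV, hMV⟩ := hV.exists_eigenvalues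
  have hU' : U * Uᵀ = 1 := mul_eq_one_comm.mp hU
  have hd0 : ∀ i, 0 ≤ d i := by
    have h1 : (diagonal d).PosSemidef := by
      have h2 := hQ.conjTranspose_mul_mul_same U
      rw [conjTranspose_eq_transpose_of_trivial, hM] at h2
      have h3 : Uᵀ * (U * diagonal d * Uᵀ) * U = diagonal d := by
        calc Uᵀ * (U * diagonal d * Uᵀ) * U = (Uᵀ * U) * diagonal d * (Uᵀ * U) := by
              simp only [Matrix.mul_assoc]
          _ = _ := by rw [hU]; simp
      rwa [h3] at h2
    exact posSemidef_diagonal_iff.1 h1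
  have hrank : Fintype.card {i // d i ≠ 0} = K := by
    rw [← rank_diagonal, ← hr, hM]
    rw [rank_mul_eq_left_of_isUnit_det, rank_mul_eq_right_of_isUnit_det]
    · exact (isUnit_iff_isUnit_det U).1 (IsUnit.of_mul_eq_one _ hU')
    · exact (isUnit_iff_isUnit_det Uᵀ).1 (IsUnit.of_mul_eq_one _ hU)
  have hzero : ∀ i : Fin n, K ≤ i → d i = 0 := by
    intro i hi
    by_contra hne
    have hpos : 0 < d i := lt_of_le_of_ne (hd0 i) (Ne.symm hne)
    have h1 : Finset.Iic i ⊆ Finset.univ.filter fun j => d j ≠ 0 := fun j hj =>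
      Finset.mem_filter.2 ⟨Finset.mem_univ _, (hpos.trans_le (hd (Finset.mem_Iic.1 hj))).ne'⟩
    have h2 := Finset.card_le_card h1
    rw [Fin.card_Iic, ← Fintype.card_subtype, hrank] at h2
    omega
  have hpos : ∀ i : Fin n, (i : ℕ) < K → 0 < d i := by
    intro i hi
    refine lt_of_le_of_ne (hd0 i) fun h0 => ?_
    have h1 : (Finset.univ.filter fun j => d j ≠ 0) ⊆ Finset.Iio i := fun j hj => by
      simp only [Finset.mem_filter, Finset.mem_univ, true_and] at hj
      rw [Finset.mem_Iio]
      by_contra hji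
      exact hj (le_antisymm ((hd (not_lt.1 hji)).trans h0.symm.le) (hd0 j))
    have h2 := Finset.card_le_card h1
    rw [Fin.card_Iio, ← Fintype.card_subtype, hrank] at h2
    omega
  refine ⟨fun k => d (Fin.castLE hK k), ?_, fun k => hpos _ k.2, fun k => ?_⟩
  · obtain ⟨r, rfl⟩ := Nat.exists_eq_add_of_le hK
    ext i j
    have hcast : ∀ k : Fin K, Fin.castLE hK k = Fin.castAdd r k := fun k => rfl
    rw [hM, Matrix.mul_apply, Matrix.mul_apply, Fin.sum_univ_add]
    simp only [mul_diagonal, transpose_apply, hVU, hcast]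
    rw [add_eq_left]
    refine Finset.sum_eq_zero fun k _ => ?_
    rw [hzero (Fin.natAdd K k) (by simp)]
    simp
  · have h1 : Q *ᵥ V.col k = d (Fin.castLE hK k) • V.col k := by
      ext i
      have := congrFun (congrFun hMV i) k
      rw [mul_diagonal, Matrix.mul_apply] at this
      simpa [mulVec, dotProduct, mul_comm] using this
    refine Module.End.hasEigenvalue_of_hasEigenvector (x := V.col k)
      ⟨Module.End.mem_eigenspace_iff.2 (by simpa using h1), fun h0 => ?_⟩
    have h2 := congrFun (congrFun hVV k) k
    have h3 : ∀ i, V i k = 0 := fun i => congrFun h0 i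
    simp [Matrix.mul_apply, h3] at h2

lemma nonneg_of_hasEigenvalue {Q : Matrix (Fin n) (Fin n) ℝ} (hQ : Q.PosSemidef) {x : ℝ}
    (hx : Module.End.HasEigenvalue (Matrix.toLin' Q) x) : 0 ≤ x := by
  obtain ⟨v, hv⟩ := hx.exists_hasEigenvector
  have h1 : Q *ᵥ v = x • v := by simpa using hv.apply_eq_smul
  have h2 := hQ.dotProduct_mulVec_nonneg v
  rw [star_trivial, h1, dotProduct_smul, smul_eq_mul] at h2
  have h3 : 0 < v ⬝ᵥ v := by
    have h0 : 0 ≤ v ⬝ᵥ v := Finset.sum_nonneg fun i _ => mul_self_nonneg _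
    exact lt_of_le_of_ne h0 fun h => hv.2 (dotProduct_self_eq_zero.1 h.symm)
  exact nonneg_of_mul_nonneg_left h2 h3

lemma lambdaMin_nonneg {Q : Matrix (Fin n) (Fin n) ℝ} (hQ : Q.PosSemidef) : 0 ≤ lambdaMin Q := by
  refine Real.sInf_nonneg ?_
  rintro x ⟨-, hx⟩
  exact nonneg_of_hasEigenvalue hQ hx

/-- The smallest nonzero eigenvalue of a nonzero positive semidefinite matrix is positive and a
lower bound of the leading eigenvalues. -/
lemma IsLeadingEigenvectors.lambdaMin_pos {Q : Matrix (Fin n) (Fin n) ℝ}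
    {V : Matrix (Fin n) (Fin K) ℝ} (hV : IsLeadingEigenvectors Q V) (hQ : Q.PosSemidef)
    (hr : Q.rank = K) (hK : 0 < K) :
    0 < lambdaMin Q ∧ ∃ d : Fin K → ℝ, Q = V * diagonal d * Vᵀ ∧ ∀ k, lambdaMin Q ≤ d k := by
  obtain ⟨d, hd, hpos, heig⟩ := hV.eq_of_rank_eq hQ hr
  set S := {x : ℝ | x ≠ 0 ∧ Module.End.HasEigenvalue (Matrix.toLin' Q) x}
  have hnn : ∀ x ∈ S, 0 ≤ x := fun x hx => nonneg_of_hasEigenvalue hQ hx.2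
  have hmem : ∀ k, d k ∈ S := fun k => ⟨(hpos k).ne', heig k⟩
  have hfin : S.Finite := (Module.End.finite_hasEigenvalue (Matrix.toLin' Q)).subset
    fun x hx => hx.2
  have hmin : lambdaMin Q ∈ S := Set.Nonempty.csInf_mem ⟨_, hmem ⟨0, hK⟩⟩ hfin
  exact ⟨lt_of_le_of_ne (hnn _ hmin) (Ne.symm hmin.1), d, hd,
    fun k => csInf_le ⟨0, hnn⟩ (hmem k)⟩

end Eigen

/-! ### Second-order perturbation of the averaged projections -/

section Perturbation

lemma norm_average_le {m k L : ℕ} (hL : 0 < L) {f : Fin L → Matrix (Fin m) (Fin k) ℝ} {b : ℝ}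
    (h : ∀ l, ‖f l‖ ≤ b) : ‖(L : ℝ)⁻¹ • ∑ l, f l‖ ≤ b := by
  have hL' : (0 : ℝ) < L := Nat.cast_pos.2 hL
  have h1 : ‖∑ l, f l‖ ≤ L * b := by
    simpa using norm_sum_le_of_le Finset.univ fun l _ => h l
  rw [norm_smul, Real.norm_eq_abs, abs_of_pos (inv_pos.2 hL'), inv_mul_le_iff₀ hL']
  exact h1

lemma average_sub {m k L : ℕ} (hL : 0 < L) (f : Fin L → Matrix (Fin m) (Fin k) ℝ)
    (A : Matrix (Fin m) (Fin k) ℝ) :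
    (L : ℝ)⁻¹ • ∑ l, (f l - A) = (L : ℝ)⁻¹ • ∑ l, f l - A := by
  have hL' : (L : ℝ) ≠ 0 := (Nat.cast_pos.2 hL).ne'
  rw [Finset.sum_sub_distrib, smul_sub, Finset.sum_const, Finset.card_univ, Fintype.card_fin,
    ← Nat.cast_smul_eq_nsmul ℝ, smul_smul, inv_mul_cancel₀ hL', one_smul]

variable {n K : ℕ}

/-- First-order expansion of the off-diagonal block of a perturbed spectral projection `P = WWᵀ`:
with `Π = VVᵀ` and the pseudo-inverse `Q⁺` of `Q`, the block `(1 - Π) P Π` is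
`(1 - Π)(M - Q) Q⁺` up to a quadratic error. It rests on `M P = P M` and `(1 - Π) Q = 0`. -/
lemma norm_offDiagonal_sub_le {Q M Qp : Matrix (Fin n) (Fin n) ℝ}
    {V W : Matrix (Fin n) (Fin K) ℝ} {lam δ : ℝ} (hlam : 0 < lam)
    (hV : Vᵀ * V = 1) (hW : Wᵀ * W = 1)
    (hcomm : M * (W * Wᵀ) = W * Wᵀ * M) (hPQ : (1 - V * Vᵀ) * Q = 0)
    (hQp : Q * Qp = V * Vᵀ) (hVQp : V * Vᵀ * Qp = Qp) (hQpn : ‖Qp‖ ≤ 1 / lam)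
    (hE : ‖M - Q‖ ≤ δ * lam) (hres : ‖(1 - V * Vᵀ) * W‖ ≤ 2 * δ)
    (hdist : ‖W * Wᵀ - V * Vᵀ‖ ≤ 6 * δ) :
    ‖(1 - V * Vᵀ) * (W * Wᵀ) * (V * Vᵀ) - (1 - V * Vᵀ) * (M - Q) * Qp‖ ≤ 8 * δ ^ 2 := by
  set J := 1 - V * Vᵀ with hJ
  have hJn : ‖J‖ ≤ 1 := norm_one_sub_projection_le_one hV
  have hexp : J * (W * Wᵀ) * (V * Vᵀ) - J * (M - Q) * Qp =
      J * (M - Q) * (W * Wᵀ - V * Vᵀ) * Qp - J * W * Wᵀ * (M - Q) * Qp := by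
    -- both sides equal `J P Q Q⁺ - J E Q⁺`
    have h1 : J * (M - Q) * (W * Wᵀ) * Qp = J * (W * Wᵀ) * M * Qp := by
      rw [Matrix.mul_sub, hPQ, sub_zero, Matrix.mul_assoc J, hcomm, ← Matrix.mul_assoc J]
    have h2 : J * (M - Q) * (V * Vᵀ) * Qp = J * (M - Q) * Qp := by
      rw [Matrix.mul_assoc, hVQp]
    have h3 : J * W * Wᵀ * (M - Q) * Qp =
        J * (W * Wᵀ) * M * Qp - J * (W * Wᵀ) * (V * Vᵀ) := by
      rw [← hQp]
      simp only [Matrix.mul_sub, Matrix.sub_mul, Matrix.mul_assoc]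
    rw [Matrix.mul_sub (J * (M - Q)), Matrix.sub_mul (J * (M - Q) * (W * Wᵀ)), h1, h2, h3]
    abel
  rw [hexp]
  have h1 : ‖J * (M - Q) * (W * Wᵀ - V * Vᵀ) * Qp‖ ≤ 1 * (δ * lam) * (6 * δ) * (1 / lam) :=
    norm_mul_le_of_le (norm_mul_le_of_le (norm_mul_le_of_le hJn hE) hdist) hQpn
  have h2 : ‖J * W * Wᵀ * (M - Q) * Qp‖ ≤ 2 * δ * 1 * (δ * lam) * (1 / lam) :=
    norm_mul_le_of_le (norm_mul_le_of_le (norm_mul_le_of_le hres (norm_transpose_le_one hW)) hE)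
      hQpn
  have h3 := norm_sub_le (J * (M - Q) * (W * Wᵀ - V * Vᵀ) * Qp) (J * W * Wᵀ * (M - Q) * Qp)
  have h4 : 1 * (δ * lam) * (6 * δ) * (1 / lam) = 6 * δ ^ 2 := by field_simp
  have h5 : 2 * δ * 1 * (δ * lam) * (1 / lam) = 2 * δ ^ 2 := by field_simp
  linarith

lemma IsLeadingEigenvectors.comm_projection {M : Matrix (Fin n) (Fin n) ℝ}
    {W : Matrix (Fin n) (Fin K) ℝ} (h : IsLeadingEigenvectors M W) :
    M * (W * Wᵀ) = W * Wᵀ * M := by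
  obtain ⟨hK, U, d, -, -, hM, -, -, hMW⟩ := h.exists_eigenvalues
  have hMt : Mᵀ = M := by
    rw [hM]
    simp [transpose_mul, Matrix.mul_assoc]
  have h1 := congrArg transpose hMW
  rw [transpose_mul, transpose_mul, hMt, diagonal_transpose] at h1
  rw [← Matrix.mul_assoc, hMW, Matrix.mul_assoc W Wᵀ, h1, Matrix.mul_assoc]

/-- Deterministic error bound for the aggregation of local eigen-spaces: if every local matrix
`M l` is within `δ lam` of `Q`, then the output is within `O(δ²)` plus the relative error of the
average of the local matrices. -/
theorem dist_qr_average_le {L : ℕ} (o : Fin L) {Q : Matrix (Fin n) (Fin n) ℝ}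
    {M : Fin L → Matrix (Fin n) (Fin n) ℝ} {V Vt : Matrix (Fin n) (Fin K) ℝ}
    {W : Fin L → Matrix (Fin n) (Fin K) ℝ} {Z : Fin L → Matrix (Fin K) (Fin K) ℝ}
    {R : Matrix (Fin K) (Fin K) ℝ} {d : Fin K → ℝ} {lam δ : ℝ} (hlam : 0 < lam)
    (hδ0 : 0 ≤ δ) (hδ : δ ≤ 1 / 50) (hV : Vᵀ * V = 1) (hQ : Q = V * diagonal d * Vᵀ)
    (hd : ∀ k, lam ≤ d k) (hE : ∀ l, ‖M l - Q‖ ≤ δ * lam)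
    (hW : ∀ l, IsLeadingEigenvectors (M l) (W l)) (hZ : ∀ l, IsProcrustes (W o) (W l) (Z l))
    (hqr : IsQR ((L : ℝ)⁻¹ • ∑ l, W l * Z l) Vt R) :
    dist Vt V ≤ 936 * δ ^ 2 + 6 * (‖(L : ℝ)⁻¹ • ∑ l, M l - Q‖ / lam) := by
  have hL : 0 < L := o.pos
  have hdpos : ∀ k, 0 < d k := fun k => hlam.trans_le (hd k)
  have hWW : ∀ l, (W l)ᵀ * W l = 1 := fun l => (hW l).transpose_mul_self
  have hres : ∀ l, ‖(1 - V * Vᵀ) * W l‖ ≤ 2 * δ := fun l =>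
    (hW l).norm_residual_le hlam hV hQ hd (hE l) (by linarith)
  have hdist : ∀ l, ‖W l * (W l)ᵀ - V * Vᵀ‖ ≤ 6 * δ := fun l => by
    linarith [norm_projection_sub_le (hWW l) hV, hres l]
  set J := 1 - V * Vᵀ with hJ
  have hJn : ‖J‖ ≤ 1 := norm_one_sub_projection_le_one hV
  -- the pseudo-inverse of `Q`
  set Qp := V * diagonal (fun k => (d k)⁻¹) * Vᵀ with hQp
  have hJV : J * V = 0 := by
    rw [hJ, Matrix.sub_mul, Matrix.mul_assoc, hV]
    simp
  have hJQ : J * Q = 0 := by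
    rw [hQ, Matrix.mul_assoc, ← Matrix.mul_assoc, hJV, Matrix.zero_mul]
  have hQQp : Q * Qp = V * Vᵀ := by
    calc Q * Qp = V * diagonal d * (Vᵀ * V) * diagonal (fun k => (d k)⁻¹) * Vᵀ := by
          rw [hQ, hQp]
          simp only [Matrix.mul_assoc]
      _ = V * Vᵀ := by
          rw [hV, Matrix.mul_one, Matrix.mul_assoc V, diagonal_mul_diagonal]
          simp [(hdpos _).ne']
  have hVQp : V * Vᵀ * Qp = Qp := by
    calc V * Vᵀ * Qp = V * (Vᵀ * V) * diagonal (fun k => (d k)⁻¹) * Vᵀ := by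
          rw [hQp]
          simp only [Matrix.mul_assoc]
      _ = Qp := by rw [hV, Matrix.mul_one]
  have hQpn : ‖Qp‖ ≤ 1 / lam := by
    have h1 : ‖diagonal (fun k => (d k)⁻¹)‖ ≤ 1 / lam := by
      rw [l2_opNorm_diagonal]
      refine (pi_norm_le_iff_of_nonneg (by positivity)).2 fun k => ?_
      rw [Real.norm_eq_abs, abs_of_pos (inv_pos.2 (hdpos k)), one_div]
      exact inv_anti₀ hlam (hd k)
    simpa using norm_mul_le_of_le (norm_mul_le_of_le (norm_le_one_of_transpose_mul_self hV) h1)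
      (norm_transpose_le_one hV)
  -- the averaged projection and its off-diagonal block
  set Pbar := (L : ℝ)⁻¹ • ∑ l, W l * (W l)ᵀ with hPbar
  set Ebar := (L : ℝ)⁻¹ • ∑ l, M l - Q with hEbar
  have hoff : ‖J * Pbar * (V * Vᵀ)‖ ≤ 8 * δ ^ 2 + ‖Ebar‖ / lam := by
    have h1 : J * Pbar * (V * Vᵀ) - J * Ebar * Qp = (L : ℝ)⁻¹ • ∑ l,
        (J * (W l * (W l)ᵀ) * (V * Vᵀ) - J * (M l - Q) * Qp) := by
      rw [hEbar, ← average_sub hL, hPbar]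
      simp only [Matrix.mul_smul, Matrix.smul_mul, Matrix.mul_sum, Matrix.sum_mul, ← smul_sub,
        ← Finset.sum_sub_distrib]
    have h2 : ‖J * Pbar * (V * Vᵀ) - J * Ebar * Qp‖ ≤ 8 * δ ^ 2 := by
      rw [h1]
      exact norm_average_le hL fun l => norm_offDiagonal_sub_le hlam hV (hWW l)
        (hW l).comm_projection hJQ hQQp hVQp hQpn (hE l) (hres l) (hdist l)
    have h3 : ‖J * Ebar * Qp‖ ≤ 1 * ‖Ebar‖ * (1 / lam) :=
      norm_mul_le_of_le (norm_mul_le_of_le hJn le_rfl) hQpn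
    have h4 := norm_le_norm_sub_add (J * Pbar * (V * Vᵀ)) (J * Ebar * Qp)
    have h5 : 1 * ‖Ebar‖ * (1 / lam) = ‖Ebar‖ / lam := by ring
    linarith
  have hJP : ‖J * Pbar‖ ≤ 2 * δ := by
    rw [hPbar, Matrix.mul_smul, Matrix.mul_sum]
    refine norm_average_le hL fun l => ?_
    rw [← Matrix.mul_assoc]
    simpa using norm_mul_le_of_le (hres l) (norm_transpose_le_one (hWW l))
  have hJPW : ‖J * Pbar * W o‖ ≤ 12 * δ ^ 2 + ‖Ebar‖ / lam := by
    have h1 : J * Pbar * W o = J * Pbar * (V * Vᵀ) * W o + J * Pbar * (J * (J * W o)) := by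
      rw [← Matrix.mul_assoc J J, hJ, one_sub_projection_mul_self hV, ← hJ]
      conv_lhs => rw [show W o = V * Vᵀ * W o + J * W o by
        rw [hJ, Matrix.sub_mul, Matrix.one_mul]; abel]
      rw [Matrix.mul_add]
      simp only [Matrix.mul_assoc]
    have h2 := norm_mul_le_of_le hoff (norm_le_one_of_transpose_mul_self (hWW o))
    have h3 := norm_mul_le_of_le hJP (norm_mul_le_of_le hJn (hres o))
    rw [h1]
    refine (norm_add_le _ _).trans ?_
    nlinarith
  -- alignment replaces `W l * Z l` by the projection of the reference `W o`
  have hproj : ∀ l, ‖(1 - W l * (W l)ᵀ) * W o‖ ≤ 12 * δ := fun l => by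
    have h1 : (1 - W l * (W l)ᵀ) * W o =
        ((W o * (W o)ᵀ - V * Vᵀ) - (W l * (W l)ᵀ - V * Vᵀ)) * W o := by
      rw [sub_sub_sub_cancel_right, Matrix.sub_mul, Matrix.sub_mul, Matrix.one_mul,
        Matrix.mul_assoc (W o), hWW o, Matrix.mul_one]
    have h2 := (norm_sub_le (W o * (W o)ᵀ - V * Vᵀ) (W l * (W l)ᵀ - V * Vᵀ)).trans
      (add_le_add (hdist o) (hdist l))
    rw [h1]
    have h3 := norm_mul_le_of_le h2 (norm_le_one_of_transpose_mul_self (hWW o))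
    linarith
  have halign : ∀ l, ‖W l * Z l - W l * (W l)ᵀ * W o‖ ≤ 144 * δ ^ 2 := fun l => by
    have h1 := (hZ l).norm_sub_le (hWW o) (hWW l) (by linarith [hproj l])
    nlinarith [hproj l, norm_nonneg ((1 - W l * (W l)ᵀ) * W o)]
  set Vbar := (L : ℝ)⁻¹ • ∑ l, W l * Z l with hVbar
  have hbar : ‖Vbar - Pbar * W o‖ ≤ 144 * δ ^ 2 := by
    have h1 : Vbar - Pbar * W o = (L : ℝ)⁻¹ • ∑ l, (W l * Z l - W l * (W l)ᵀ * W o) := by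
      rw [hVbar, hPbar, Finset.sum_sub_distrib, smul_sub, Matrix.smul_mul, Matrix.sum_mul]
    rw [h1]
    exact norm_average_le hL halign
  have hbaro : ‖Vbar - W o‖ ≤ 1 / 2 := by
    rw [hVbar, ← average_sub hL]
    refine norm_average_le hL fun l => ?_
    have h1 : W l * Z l - W o = (W l * Z l - W l * (W l)ᵀ * W o) - (1 - W l * (W l)ᵀ) * W o := by
      rw [Matrix.sub_mul, Matrix.one_mul]
      abel
    rw [h1]
    refine (norm_sub_le _ _).trans ?_
    nlinarith [halign l, hproj l]
  -- the triangular factor is well conditioned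
  obtain ⟨hVR, hVt, -⟩ := hqr
  obtain ⟨S, hRS, hS⟩ := exists_inverse_norm_le_two (A := (W o)ᵀ * Vt) (Y := R)
    (by simpa using norm_mul_le_of_le (norm_transpose_le_one (hWW o))
          (norm_le_one_of_transpose_mul_self hVt))
    (by
      have h1 : 1 - (W o)ᵀ * Vt * R = -((W o)ᵀ * (Vbar - W o)) := by
        rw [Matrix.mul_sub, hWW o, hVR, Matrix.mul_assoc]
        abel
      rw [h1, norm_neg]
      simpa using norm_mul_le_of_le (norm_transpose_le_one (hWW o)) hbaro)
  have hJVbar : ‖J * Vbar‖ ≤ 156 * δ ^ 2 + ‖Ebar‖ / lam := by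
    have h1 : J * Vbar = J * (Vbar - Pbar * W o) + J * Pbar * W o := by
      rw [Matrix.mul_sub, Matrix.mul_assoc J]
      abel
    have h2 := norm_mul_le_of_le hJn hbar
    rw [h1]
    refine (norm_add_le _ _).trans ?_
    linarith
  have hJVt : ‖J * Vt‖ ≤ (156 * δ ^ 2 + ‖Ebar‖ / lam) * 2 := by
    have h1 : J * Vt = J * Vbar * S := by
      rw [hVR, Matrix.mul_assoc, Matrix.mul_assoc Vt, hRS, Matrix.mul_one]
    rw [h1]
    exact norm_mul_le_of_le hJVbar hS
  have hfin := norm_projection_sub_le hVt hV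
  rw [dist]
  linarith

end Perturbation

/-! ### The population matrices -/

section Population

variable {n K L : ℕ} (g : Fin n → Fin K)

lemma transpose_membership_mul_self :
    (membership g)ᵀ * membership g = diagonal fun k => (communitySize g k : ℝ) := by
  ext a b
  rw [Matrix.mul_apply, diagonal_apply]
  simp only [membership, transpose_apply, of_apply, ← ite_and, mul_ite, mul_one, mul_zero]
  split_ifs with hab
  · subst hab
    simp [communitySize, Finset.sum_boole]
  · refine Finset.sum_eq_zero fun i _ => if_neg ?_
    rintro ⟨h1, h2⟩
    exact hab (h2.symm.trans h1)

lemma deltaMat_sq : deltaMat g ^ 2 = diagonal fun k => (communitySize g k : ℝ) := by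
  rw [deltaMat, sq, diagonal_mul_diagonal]
  simp

lemma localTarget_eq (B : Matrix (Fin K) (Fin K) ℝ) :
    localTarget g B =
      (n : ℝ)⁻¹ • (membership g * (B * deltaMat g ^ 2 * B) * (membership g)ᵀ) := by
  rw [localTarget, deltaMat_sq, ← transpose_membership_mul_self, population, sq]
  simp only [Matrix.mul_assoc]

lemma sq_norm_membership_le : ‖membership g‖ ^ 2 ≤ n := by
  rw [← norm_transpose_mul_self, transpose_membership_mul_self, l2_opNorm_diagonal]
  refine (pi_norm_le_iff_of_nonneg (Nat.cast_nonneg _)).2 fun k => ?_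
  rw [Real.norm_eq_abs, Nat.abs_cast, Nat.cast_le]
  simpa [communitySize] using Finset.card_filter_le (Finset.univ : Finset (Fin n)) fun i => g i = k

/-- Heterogeneity of the link matrices bounds that of the local targets, since no community has
more than `n` nodes. -/
lemma LimitedHeterogeneity.norm_localTarget_sub_target_le
    {B : Fin L → Matrix (Fin K) (Fin K) ℝ} {H : ℝ} {g : Fin n → Fin K}
    (h : LimitedHeterogeneity g B H) (l : Fin L) :
    ‖localTarget g (B l) - target g B‖ ≤ H := by
  have h1 : localTarget g (B l) - target g B = (n : ℝ)⁻¹ • (membership g *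
      (B l * deltaMat g ^ 2 * B l - (L : ℝ)⁻¹ • ∑ l', B l' * deltaMat g ^ 2 * B l') *
        (membership g)ᵀ) := by
    simp only [target, localTarget_eq, Matrix.mul_sub, Matrix.sub_mul, Matrix.mul_smul,
      Matrix.smul_mul, Matrix.mul_sum, Matrix.sum_mul, smul_sub, ← Finset.smul_sum]
    rw [smul_comm]
  have hH : 0 ≤ H := (norm_nonneg _).trans (h l)
  have h2 := norm_mul_le_of_le (norm_mul_le_of_le (le_refl ‖membership g‖) (h l))
    (norm_transpose_matrix (membership g)).le
  have h3 : ‖membership g‖ * H * ‖membership g‖ ≤ n * H := by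
    nlinarith [sq_norm_membership_le g]
  rw [h1, norm_smul, norm_inv, Real.norm_natCast]
  rcases Nat.eq_zero_or_pos n with hn | hn
  · simpa [hn] using hH
  · rw [inv_mul_le_iff₀ (Nat.cast_pos.2 hn)]
    exact h2.trans h3

lemma posSemidef_target {B : Fin L → Matrix (Fin K) (Fin K) ℝ} (hB : ∀ l, IsLinkMatrix (B l)) :
    (target g B).PosSemidef := by
  refine PosSemidef.smul (posSemidef_sum _ fun l _ => ?_) (by positivity)
  refine PosSemidef.smul ?_ (by positivity)
  have h1 : (population g (B l))ᴴ = population g (B l) := by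
    rw [conjTranspose_eq_transpose_of_trivial]
    simp only [population, transpose_mul, transpose_transpose, Matrix.mul_assoc]
    rw [(hB l).isSymm]
  have h2 := posSemidef_conjTranspose_mul_self (population g (B l))
  rwa [h1, ← sq] at h2

lemma localError_nonneg (B : Fin L → Matrix (Fin K) (Fin K) ℝ) (q q' : ℝ)
    (At : Fin L → Matrix (Fin n) (Fin n) ℝ) : 0 ≤ localError g B q q' At :=
  Real.iSup_nonneg fun _ => by positivity

lemma sq_norm_localEstimator_sub_le (B : Fin L → Matrix (Fin K) (Fin K) ℝ) (q q' : ℝ)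
    (At : Fin L → Matrix (Fin n) (Fin n) ℝ) (l : Fin L) (hlam : 0 < lambdaMin (target g B)) :
    ‖localEstimator q q' (At l) - localTarget g (B l)‖ ≤
      √(localError g B q q' At) * lambdaMin (target g B) := by
  have h1 : ‖localEstimator q q' (At l) - localTarget g (B l)‖ ^ 2 / lambdaMin (target g B) ^ 2 ≤
      localError g B q q' At :=
    le_ciSup (f := fun l => ‖localEstimator q q' (At l) - localTarget g (B l)‖ ^ 2 /
      lambdaMin (target g B) ^ 2) (Set.finite_range _).bddAbove l
  rw [← div_le_iff₀ hlam]
  refine Real.le_sqrt_of_sq_le ?_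
  rwa [div_pow]

end Population

end PpDSC

theorem mainTheorem4 (c₁ C₁ : ℝ) (hc₁ : 0 ≤ c₁) (hcC : c₁ ≤ C₁) :
    ∃ c : ℝ, 0 < c ∧ ∃ C : ℝ, 0 < C ∧
      ∀ (n K L : ℕ) (g : Fin n → Fin K) (B : Fin L → Matrix (Fin K) (Fin K) ℝ) (q q' H : ℝ)
        (o : Fin L) (Ω : Type*) [MeasurableSpace Ω] (μ : MeasureTheory.Measure Ω)
        [MeasureTheory.IsProbabilityMeasure μ]
        (A At : Fin L → Ω → Matrix (Fin n) (Fin n) ℝ),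
        (∀ l, PpDSC.IsLinkMatrix (B l)) →
        1 / 2 < q → q ≤ 1 → 1 / 2 < q' → q' ≤ 1 →
        PpDSC.IsPerturbedMultilayerSBM μ g B q q' A At →
        (PpDSC.target g B).rank = K →
        PpDSC.Balanced c₁ C₁ g →
        PpDSC.LimitedHeterogeneity g B H →
        ∀ V : Matrix (Fin n) (Fin K) ℝ, PpDSC.IsLeadingEigenvectors (PpDSC.target g B) V →
        ∀ ω : Ω,
          PpDSC.localError g B q q' (fun l => At l ω) ≤ c →
          PpDSC.heterogeneityError g B H ≤ c →
          ∀ Vt : Matrix (Fin n) (Fin K) ℝ, PpDSC.IsOutput K q q' o (fun l => At l ω) Vt →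
            PpDSC.dist Vt V ≤
              C * (PpDSC.localError g B q q' (fun l => At l ω) +
                PpDSC.heterogeneityError g B H +
                PpDSC.centralizedError g B q q' (fun l => At l ω)) := by
  -- `c` makes `δ = √I₁ + √I₂` at most `1 / 50`; `1872` is `2 * 936`, from `δ² ≤ 2 (I₁ + I₂)`.
  refine ⟨1 / 10000, by norm_num, 1872, by norm_num, ?_⟩
  intro n K L g B q q' H o Ω _ μ _ A At hB _ _ _ _ _ hr _ hH V hV ω hI1 hI2 Vt hout
  have hpsd := PpDSC.posSemidef_target g hB
  have hlam0 := PpDSC.lambdaMin_nonneg hpsd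
  set I₁ := PpDSC.localError g B q q' fun l => At l ω with hI₁
  set I₂ := PpDSC.heterogeneityError g B H with hI₂
  have hI10 : 0 ≤ I₁ := PpDSC.localError_nonneg g B q q' _
  have hI20 : 0 ≤ I₂ := by
    rw [hI₂, PpDSC.heterogeneityError]
    positivity
  have hI30 : 0 ≤ PpDSC.centralizedError g B q q' fun l => At l ω :=
    div_nonneg (norm_nonneg _) hlam0
  rcases Nat.eq_zero_or_pos K with hK | hK
  · -- without communities the projections vanish
    subst hK
    have h0 : PpDSC.dist Vt V = 0 := by
      rw [PpDSC.dist, Subsingleton.elim Vt V, sub_self, norm_zero]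
    rw [h0]
    positivity
  obtain ⟨hlam, d, hQ, hd⟩ := hV.lambdaMin_pos hpsd hr hK
  obtain ⟨W, Z, R, hW, hZ, hqr⟩ := hout
  have hHle : H ≤ √I₂ * PpDSC.lambdaMin (PpDSC.target g B) := by
    rw [← div_le_iff₀ hlam]
    exact Real.le_sqrt_of_sq_le (by rw [div_pow]; exact le_rfl)
  have hE : ∀ l, ‖PpDSC.localEstimator q q' (At l ω) - PpDSC.target g B‖ ≤
      (√I₁ + √I₂) * PpDSC.lambdaMin (PpDSC.target g B) := fun l => by
    have h1 := norm_sub_le_norm_sub_add_norm_sub (PpDSC.localEstimator q q' (At l ω))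
      (PpDSC.localTarget g (B l)) (PpDSC.target g B)
    have h2 := PpDSC.sq_norm_localEstimator_sub_le g B q q' (fun l => At l ω) l hlam
    have h3 := hH.norm_localTarget_sub_target_le l
    linarith
  have hs1 : √I₁ ≤ 1 / 100 := Real.sqrt_le_iff.2 ⟨by norm_num, by linarith⟩
  have hs2 : √I₂ ≤ 1 / 100 := Real.sqrt_le_iff.2 ⟨by norm_num, by linarith⟩
  have hmain := PpDSC.dist_qr_average_le o hlam (by positivity) (by linarith) hV.transpose_mul_self
    hQ hd hE hW hZ hqr
  have hsq : (√I₁ + √I₂) ^ 2 ≤ 2 * (I₁ + I₂) := by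
    nlinarith [Real.sq_sqrt hI10, Real.sq_sqrt hI20, sq_nonneg (√I₁ - √I₂)]
  have hcen : ‖(L : ℝ)⁻¹ • ∑ l, PpDSC.localEstimator q q' (At l ω) - PpDSC.target g B‖ /
      PpDSC.lambdaMin (PpDSC.target g B) = PpDSC.centralizedError g B q q' fun l => At l ω := rfl
  rw [hcen] at hmain
  linarith
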